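/- Let $A=\{1,2,3\}$ be the ternary alphabet. A word over $A$ is squarefree if it has no factor of the form $XX$ with $X$ a nonempty word. A morphism $\varphi\colon A^*\to A^*$ of the free monoid $A^*$ of all words over $A$ is squarefree if the image of every squarefree word is squarefree, and it is uniform of rank $L$ if $|\varphi(a)|=L$ for every letter $a\in A$. Then there are exactly $144$ uniform squarefree morphisms $A^*\to A^*$ of rank $11$, and for $2\le L\le 10$ there is no uniform squarefree morphism $A^*\to A^*$ of rank $L$. -/

import Mathlib

/-- A word over `α` (an element of the free monoid) is squarefree if it contains no factor of the
form `x x` with `x` nonempty. -/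
def IsSquarefreeWord {α : Type*} (w : FreeMonoid α) : Prop :=
  ∀ u x v : FreeMonoid α, w = u * (x * x) * v → x = 1

/-- A morphism of the free monoid over `α` is squarefree if the image of every squarefree word
(of any length) is squarefree. -/
def IsSquarefreeMorphism {α : Type*} (φ : FreeMonoid α →* FreeMonoid α) : Prop :=
  ∀ w : FreeMonoid α, IsSquarefreeWord w → IsSquarefreeWord (φ w)

/-- A morphism is uniform of rank `L` if the image of every letter has length `L`. -/
def IsUniformOfRank {α : Type*} (L : ℕ) (φ : FreeMonoid α →* FreeMonoid α) : Prop :=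
  ∀ a : α, (φ (FreeMonoid.of a)).length = L

/-!
The theorem combines a criterion that makes squarefreeness of a uniform morphism a finite
condition with an exhaustive search.

The criterion (`IsUniformOfRank.isSquarefreeMorphism_iff`, due to Thue) says that a uniform morphism
`φ` of rank `L` is squarefree once the images of the words `a b c` with `a ≠ b` and `b ≠ c` are.
Such a `φ` is injective on letters, and `φ a` occurs inside `φ (b c)`, `b ≠ c`, only as a prefix or
a suffix, since otherwise `b a b` or `a c a` has an image with a square. Now let the image of a
squarefree word `w` contain a square that is not covered by three consecutive blocks. One of its two
halves contains a whole block, and the copy of that block in the other half is aligned with the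
blocks by the synchronization just stated, so the period is a multiple `κ L` of `L`. Comparing the
two halves block by block yields a square of period `κ` in `w`, except when the square starts inside
the block of a letter `a`, has its midpoint inside the block of `b` and ends inside that of `c` with
`a ≠ b` and `b ≠ c`; in that case the image of `a b c` already contains a square.

For the search, words are encoded as numbers in base `4`, so that a square prefix of period `k` is
an equality of two remainders modulo `4 ^ k`. After a permutation of the letters of the target the
image of `0` ends with `0 1`. For each such squarefree image `x` of `0`, all squarefree words `z x`
are built letter by letter, the words `z` with `z x z` and `x z x` squarefree are kept, and pairs of
them are tested with the criterion (`mem_candidates_iff`). The kernel evaluates the search: nothing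
is found for `2 ≤ L ≤ 10`, and `24` normalized morphisms for `L = 11`. The six permutations of the
letters act freely on the squarefree morphisms and every orbit has exactly one normalized element
(`ncard_squarefreeMorphisms`), which gives `6 * 24 = 144`.
-/

/-! ### Squarefreeness by positions -/

/-- The first `n` terms of the sequence `g` form a squarefree word: no two adjacent windows of the
same positive length `k` agree. -/
def SquarefreeUpTo {α : Type*} (g : ℕ → α) (n : ℕ) : Prop :=
  ∀ i k, 0 < k → i + 2 * k ≤ n → ∃ j < k, g (i + j) ≠ g (i + k + j)

theorem SquarefreeUpTo.ne_succ {α : Type*} {g : ℕ → α} {n : ℕ} (h : SquarefreeUpTo g n) {i : ℕ}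
    (hi : i + 1 < n) : g i ≠ g (i + 1) := by
  obtain ⟨j, hj, hne⟩ := h i 1 one_pos (by omega)
  obtain rfl : j = 0 := by omega
  simpa using hne

theorem isSquarefreeWord_iff_take_ne {α : Type*} (w : FreeMonoid α) :
    IsSquarefreeWord w ↔ ∀ i k, 0 < k → i + 2 * k ≤ w.toList.length →
      (w.toList.drop i).take k ≠ (w.toList.drop (i + k)).take k := by
  constructor
  · intro h i k hk hik heq
    have := h (.ofList (w.toList.take i)) (.ofList ((w.toList.drop i).take k))
      (.ofList (w.toList.drop (i + k + k))) <| by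
        apply FreeMonoid.toList.injective
        simp only [FreeMonoid.toList_mul, FreeMonoid.toList_ofList]
        nth_rewrite 2 [heq]
        rw [← List.drop_drop (i := k) (j := i + k), List.append_assoc, List.append_assoc,
          List.take_append_drop, ← List.drop_drop (i := k) (j := i), List.take_append_drop,
          List.take_append_drop]
    have := congrArg FreeMonoid.length this
    simp only [FreeMonoid.length, FreeMonoid.toList_ofList, List.length_take, List.length_drop,
      FreeMonoid.toList_one, List.length_nil] at this
    omega
  · intro h u x v hw
    by_contra hx
    have hx' : 0 < x.toList.length := List.length_pos_iff.2 hx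
    refine h u.toList.length x.toList.length hx' ?_ ?_
    · rw [hw]; simp; omega
    · rw [hw]
      simp only [FreeMonoid.toList_mul, List.append_assoc]
      rw [List.drop_left, List.take_left, ← List.append_assoc, ← List.length_append,
        List.drop_left, List.take_left]

theorem isSquarefreeWord_iff_squarefreeUpTo {α : Type*} (w : FreeMonoid α) (d : α) :
    IsSquarefreeWord w ↔ SquarefreeUpTo (fun i => w.toList.getD i d) w.length := by
  rw [isSquarefreeWord_iff_take_ne]
  refine forall_congr' fun i => forall_congr' fun k => forall_congr' fun hk =>
    forall_congr' fun hik => ?_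
  rw [← not_iff_not]
  push Not
  constructor
  · intro h j hj
    have := congrArg (fun l => l.getD j d) h
    simpa [List.getD_eq_getElem?_getD, List.getElem?_take, hj] using this
  · intro h
    apply List.ext_getElem
    · simp; omega
    · intro j h1 h2
      simp only [List.length_take, List.length_drop] at h1 h2
      have := h j (by omega)
      rw [List.getD_eq_getElem _ _ (by omega), List.getD_eq_getElem _ _ (by omega)] at this
      simpa using this

theorem IsSquarefreeWord.of_mul_left {α : Type*} {u v : FreeMonoid α}
    (h : IsSquarefreeWord (u * v)) : IsSquarefreeWord u := fun p x q hu =>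
  h p x (q * v) (by rw [hu]; simp only [mul_assoc])

theorem isSquarefreeWord_three {α : Type*} {a b c : α} (hab : a ≠ b) (hbc : b ≠ c) :
    IsSquarefreeWord (FreeMonoid.of a * FreeMonoid.of b * FreeMonoid.of c) := by
  rw [isSquarefreeWord_iff_squarefreeUpTo _ a]
  intro i k hk hik
  simp only [FreeMonoid.length_mul, FreeMonoid.length_of] at hik
  obtain rfl : k = 1 := by omega
  refine ⟨0, one_pos, ?_⟩
  obtain rfl | rfl : i = 0 ∨ i = 1 := by omega
  · simpa using hab
  · simpa using hbc

theorem isSquarefreeWord_of {α : Type*} (a : α) : IsSquarefreeWord (FreeMonoid.of a) := by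
  rw [isSquarefreeWord_iff_take_ne]
  intro i k hk hik
  simp only [FreeMonoid.toList_of, List.length_singleton] at hik
  omega

/-! ### Uniform morphisms are tested on words of length three -/

section Blocks

variable {α γ : Type*} {L : ℕ} {f : α → ℕ → γ}

/-- The sequence obtained from `w` by replacing each term `a` with the block
`f a 0, …, f a (L - 1)`. -/
def blockSeq (L : ℕ) (f : α → ℕ → γ) (w : ℕ → α) (m : ℕ) : γ := f (w (m / L)) (m % L)

theorem blockSeq_mul_add {w : ℕ → α} {q r : ℕ} (hr : r < L) :
    blockSeq L f w (q * L + r) = f (w q) r := by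
  have hL : 0 < L := by omega
  rw [blockSeq, mul_comm, Nat.mul_add_div hL, Nat.div_eq_of_lt hr, Nat.mul_add_mod,
    Nat.mod_eq_of_lt hr, add_zero]

theorem blockSeq_of_eq {w : ℕ → α} {m : ℕ} (q r : ℕ) (hm : m = q * L + r) (hr : r < L) :
    blockSeq L f w m = f (w q) r := hm ▸ blockSeq_mul_add hr

/-- The sequence `a, b, c, c, …`. -/
def tripleSeq (a b c : α) : ℕ → α
  | 0 => a
  | 1 => b
  | _ => c

/-- The substitution of blocks for letters keeps the words `a b c` with `a ≠ b ≠ c` squarefree. -/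
def SquarefreeOnTriples (L : ℕ) (f : α → ℕ → γ) : Prop :=
  ∀ a b c, a ≠ b → b ≠ c → SquarefreeUpTo (blockSeq L f (tripleSeq a b c)) (3 * L)

theorem SquarefreeOnTriples.block_injective (H : SquarefreeOnTriples L f) (hL : 0 < L) {a b : α}
    (h : ∀ r < L, f a r = f b r) : a = b := by
  by_contra hab
  obtain ⟨j, hj, hne⟩ := H a b a hab (Ne.symm hab) 0 L hL (by omega)
  apply hne
  rw [blockSeq_of_eq 0 j (by omega) hj, blockSeq_of_eq 1 j (by omega) hj]
  exact h j hj

/-- Synchronization: a block occurs in the product of the blocks of two distinct letters `b`, `c`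
only as a prefix or a suffix. Otherwise it is the block of `b` or of `c`, or else `b a b` or
`a c a` has an image with a square. -/
theorem SquarefreeOnTriples.synchronized (H : SquarefreeOnTriples L f) {a b c : α} (hbc : b ≠ c)
    {s : ℕ} (hs : 0 < s) (hsL : s < L) (h1 : ∀ r, r + s < L → f a r = f b (s + r))
    (h2 : ∀ t < s, f a (L - s + t) = f c t) : False := by
  by_cases hab : a = b
  · have hac : a ≠ c := hab ▸ hbc
    obtain ⟨j, hj, hne⟩ := H a c a hac hac.symm (L - s) s hs (by omega)
    apply hne
    rw [blockSeq_of_eq 0 (L - s + j) (by omega) (by omega),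
      blockSeq_of_eq 1 j (by omega) (by omega)]
    exact h2 j hj
  · obtain ⟨j, hj, hne⟩ := H b a b (Ne.symm hab) hab s (L - s) (by omega) (by omega)
    apply hne
    rw [blockSeq_of_eq 0 (s + j) (by omega) (by omega),
      blockSeq_of_eq 1 j (by omega) (by omega)]
    exact (h1 j (by omega)).symm

/-- A block occurring in the image of a squarefree word starts at a multiple of `L`. -/
theorem SquarefreeOnTriples.dvd_of_block_occurs (H : SquarefreeOnTriples L f) (hL : 0 < L)
    {w : ℕ → α} {n : ℕ} (hw : SquarefreeUpTo w n) {a : α} {P : ℕ} (hP : P + L ≤ n * L)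
    (h : ∀ r < L, f a r = blockSeq L f w (P + r)) : L ∣ P := by
  by_contra hdvd
  have hs : 0 < P % L := Nat.pos_of_ne_zero fun h0 => hdvd (Nat.dvd_of_mod_eq_zero h0)
  have hsL : P % L < L := Nat.mod_lt _ hL
  obtain ⟨q, s, hq, hs', hqs⟩ : ∃ q s, 0 < s ∧ s < L ∧ P = q * L + s :=
    ⟨P / L, P % L, hs, hsL, (Nat.div_add_mod' P L).symm⟩
  have hqn : q + 1 < n := by
    by_contra hcon
    have : n * L ≤ (q + 1) * L := Nat.mul_le_mul_right _ (by omega)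
    rw [Nat.add_mul] at this
    omega
  refine H.synchronized (hw.ne_succ hqn) hq hs' (a := a) (fun r hr => ?_) fun t ht => ?_
  · rw [h r (by omega), blockSeq_of_eq q (s + r) (by omega) (by omega)]
  · rw [h (L - s + t) (by omega),
      blockSeq_of_eq (q + 1) t (by rw [Nat.add_mul]; omega) (by omega)]

/-- A square in the image of a squarefree word does not lie within three consecutive blocks. The
padding by `exists_ne` is for windows that reach the end of the word. -/
theorem SquarefreeOnTriples.exists_ne_of_short [Nontrivial α] (H : SquarefreeOnTriples L f)
    (hL : 0 < L) {w : ℕ → α} {n : ℕ} (hw : SquarefreeUpTo w n) {i k q p : ℕ} (hi : i = q * L + p)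
    (hk : 0 < k) (hn : i + 2 * k ≤ n * L) (h3 : p + 2 * k ≤ 3 * L) :
    ∃ j < k, blockSeq L f w (i + j) ≠ blockSeq L f w (i + k + j) := by
  obtain ⟨b, hab, hb⟩ : ∃ b, w q ≠ b ∧ (q + 1 < n → b = w (q + 1)) := by
    by_cases h : q + 1 < n
    · exact ⟨_, hw.ne_succ h, fun _ => rfl⟩
    · obtain ⟨b, hb⟩ := exists_ne (w q)
      exact ⟨b, hb.symm, fun h' => absurd h' h⟩
  obtain ⟨c, hbc, hc⟩ : ∃ c, b ≠ c ∧ (q + 2 < n → c = w (q + 2)) := by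
    by_cases h : q + 2 < n
    · exact ⟨_, hb (by omega) ▸ hw.ne_succ (i := q + 1) h, fun _ => rfl⟩
    · obtain ⟨c, hc⟩ := exists_ne b
      exact ⟨c, hc.symm, fun h' => absurd h' h⟩
  have key : ∀ x < 3 * L, q * L + x < n * L →
      blockSeq L f w (q * L + x) = blockSeq L f (tripleSeq (w q) b c) x := by
    intro x hx hxn
    have hr := Nat.mod_lt x hL
    have hx' := Nat.div_add_mod' x L
    have ht : x / L < 3 := Nat.div_lt_of_lt_mul (by omega)
    generalize x / L = t at ht hx'
    generalize x % L = r at hr hx'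
    have hqt : q + t < n := by
      by_contra hcon
      have : n * L ≤ (q + t) * L := Nat.mul_le_mul_right _ (by omega)
      rw [Nat.add_mul] at this
      omega
    rw [blockSeq_of_eq (q + t) r (by rw [Nat.add_mul]; omega) hr,
      blockSeq_of_eq t r hx'.symm hr]
    obtain rfl | rfl | rfl : t = 0 ∨ t = 1 ∨ t = 2 := by omega
    · rfl
    · rw [← hb hqt]; rfl
    · rw [← hc hqt]; rfl
  obtain ⟨j, hj, hne⟩ := H _ b c hab hbc p k hk h3
  refine ⟨j, hj, ?_⟩
  rwa [hi, show q * L + p + j = q * L + (p + j) by omega,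
    show q * L + p + k + j = q * L + (p + k + j) by omega, key _ (by omega) (by omega),
    key _ (by omega) (by omega)]

/-- The image of a squarefree word has no square whose period is a multiple of `L`: such a square
comes from one in the word, or from one in the image of three of its letters. -/
theorem SquarefreeOnTriples.exists_ne_of_aligned (H : SquarefreeOnTriples L f) (hL : 0 < L)
    {w : ℕ → α} {n : ℕ} (hw : SquarefreeUpTo w n) {i κ q p : ℕ} (hi : i = q * L + p) (hp : p < L)
    (hκ : 0 < κ) (hn : i + 2 * (κ * L) ≤ n * L) :
    ∃ j < κ * L, blockSeq L f w (i + j) ≠ blockSeq L f w (i + κ * L + j) := by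
  by_contra! hcon
  -- The square at the level of blocks: `r` is the offset within the block `q + t`.
  have key : ∀ t r, r < L → p ≤ t * L + r → t * L + r < p + κ * L →
      f (w (q + t)) r = f (w (q + κ + t)) r := by
    intro t r hr h1 h2
    have := hcon (t * L + r - p) (by omega)
    rwa [blockSeq_of_eq (q + t) r (by rw [Nat.add_mul]; omega) hr,
      blockSeq_of_eq (q + κ + t) r (by rw [Nat.add_mul, Nat.add_mul]; omega) hr] at this
  have inner : ∀ t, 0 < t → t < κ → w (q + t) = w (q + κ + t) := by
    intro t ht0 ht
    refine H.block_injective hL fun r hr => key t r hr ?_ ?_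
    · have : 1 * L ≤ t * L := Nat.mul_le_mul_right _ ht0
      omega
    · have : (t + 1) * L ≤ κ * L := Nat.mul_le_mul_right _ ht
      rw [Nat.add_mul] at this
      omega
  have noFirst : q + 2 * κ ≤ n → w q ≠ w (q + κ) := by
    intro hle h0
    obtain ⟨j, hj, hne⟩ := hw q κ hκ hle
    rcases Nat.eq_zero_or_pos j with rfl | hj0
    · exact hne h0
    · exact hne (inner j hj0 hj)
  have hq : q + 2 * κ ≤ n := by
    apply Nat.le_of_mul_le_mul_right _ hL
    rw [Nat.add_mul, mul_assoc]
    omega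
  have hκL : L ≤ κ * L := Nat.le_mul_of_pos_left _ hκ
  rcases Nat.eq_zero_or_pos p with rfl | hp0
  · refine noFirst hq (H.block_injective hL fun r hr => ?_)
    simpa using key 0 r hr (by omega) (by omega)
  · have hq1 : q + 1 + 2 * κ ≤ n := by
      have : q + 2 * κ < n := by
        apply Nat.lt_of_mul_lt_mul_right (a := L)
        rw [Nat.add_mul, mul_assoc]
        omega
      omega
    have hlast : w (q + κ) ≠ w (q + κ + κ) := by
      intro h0
      obtain ⟨j, hj, hne⟩ := hw (q + 1) κ hκ hq1
      apply hne
      rcases Nat.lt_or_ge (j + 1) κ with hj1 | hj1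
      · convert inner (j + 1) (by omega) hj1 using 2 <;> omega
      · obtain rfl : κ = j + 1 := by omega
        convert h0 using 2 <;> omega
    obtain ⟨j, hj, hne⟩ := H _ _ _ (noFirst hq) hlast p L hL (by omega)
    apply hne
    rcases Nat.lt_or_ge (p + j) L with hj1 | hj1
    · rw [blockSeq_of_eq 0 (p + j) (by omega) hj1, blockSeq_of_eq 1 (p + j) (by omega) hj1]
      exact key 0 (p + j) hj1 (by omega) (by omega)
    · rw [blockSeq_of_eq 1 (p + j - L) (by omega) (by omega),
        blockSeq_of_eq 2 (p + j - L) (by omega) (by omega)]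
      exact key κ (p + j - L) (by omega) (by omega) (by omega)

theorem SquarefreeOnTriples.squarefreeUpTo_blockSeq [Nontrivial α] (H : SquarefreeOnTriples L f)
    (hL : 0 < L) {w : ℕ → α} {n : ℕ} (hw : SquarefreeUpTo w n) :
    SquarefreeUpTo (blockSeq L f w) (n * L) := by
  intro i k hk hn
  obtain ⟨q, p, hp, hi⟩ : ∃ q p, p < L ∧ i = q * L + p :=
    ⟨i / L, i % L, Nat.mod_lt _ hL, (Nat.div_add_mod' i L).symm⟩
  rcases Nat.lt_or_ge (3 * L) (p + 2 * k) with h3 | h3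
  swap
  · exact H.exists_ne_of_short hL hw hi hk hn h3
  by_contra! hcon
  have hqL : ∀ c, (q + c) * L = q * L + c * L := fun c => Nat.add_mul ..
  -- The blocks `q + 1` and `q + 2` lie in the square, and one of them avoids its midpoint; its
  -- copy in the other half has to be aligned, so that `L` divides `k`.
  have hdvd : L ∣ k := by
    rcases Nat.lt_or_ge (2 * L) (p + k) with hmid | hmid
    · have : L ∣ (q + 1) * L + k := by
        refine H.dvd_of_block_occurs hL hw (a := w (q + 1)) (by rw [hqL]; omega) fun r hr => ?_
        have := hcon (L - p + r) (by omega)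
        rw [blockSeq_of_eq (q + 1) r (by rw [hqL]; omega) hr] at this
        rw [this]
        congr 1
        rw [hqL]
        omega
      exact (Nat.dvd_add_right (Dvd.intro_left _ rfl)).1 this
    · have : L ∣ (q + 2) * L - k := by
        refine H.dvd_of_block_occurs hL hw (a := w (q + 2)) (by rw [hqL]; omega) fun r hr => ?_
        have := hcon (2 * L - p - k + r) (by omega)
        rw [blockSeq_of_eq (m := i + k + _) (q + 2) r (by rw [hqL]; omega) hr] at this
        rw [← this]
        congr 1
        rw [hqL]
        omega
      exact (Nat.dvd_sub_iff_right (by rw [hqL]; omega) (Dvd.intro_left _ rfl)).1 this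
  obtain ⟨κ, rfl⟩ := hdvd
  rw [mul_comm L κ] at *
  have hκ : 0 < κ := Nat.pos_of_mul_pos_right hk
  obtain ⟨j, hj, hne⟩ := H.exists_ne_of_aligned hL hw hi hp hκ hn
  exact hne (hcon j hj)

end Blocks

theorem IsUniformOfRank.length_apply {α : Type*} {L : ℕ} {φ : FreeMonoid α →* FreeMonoid α}
    (hφ : IsUniformOfRank L φ) (w : FreeMonoid α) : (φ w).length = w.length * L := by
  induction w using FreeMonoid.inductionOn' with
  | one => simp
  | of_mul a w ih => simp [hφ a, ih]; ring

theorem IsUniformOfRank.getD_apply {α : Type*} {L : ℕ} {φ : FreeMonoid α →* FreeMonoid α}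
    (hφ : IsUniformOfRank L φ) (d : α) (w : FreeMonoid α) {m : ℕ} (hm : m < w.length * L) :
    (φ w).toList.getD m d =
      blockSeq L (fun a r => (φ (FreeMonoid.of a)).toList.getD r d)
        (fun i => w.toList.getD i d) m := by
  induction w using FreeMonoid.inductionOn' generalizing m with
  | one => simp at hm
  | of_mul a w ih =>
    have hL : 0 < L := Nat.pos_of_ne_zero fun h => by simp [h] at hm
    have ha : (φ (FreeMonoid.of a)).toList.length = L := hφ a
    rw [map_mul, FreeMonoid.toList_mul]
    rcases Nat.lt_or_ge m L with h | h
    · rw [List.getD_append _ _ _ _ (by omega), blockSeq_of_eq 0 m (by omega) h]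
      simp
    · obtain ⟨m, rfl⟩ := Nat.exists_eq_add_of_le h
      rw [List.getD_append_right _ _ _ _ (by omega), ha, Nat.add_sub_cancel_left, ih, blockSeq,
        blockSeq, Nat.add_mod_left, Nat.add_div_left _ hL]
      · simp
      · rw [FreeMonoid.length_mul, FreeMonoid.length_of, Nat.add_mul] at hm
        omega

theorem SquarefreeUpTo.congr {α : Type*} {g g' : ℕ → α} {n : ℕ} (h : SquarefreeUpTo g n)
    (hg : ∀ m < n, g m = g' m) : SquarefreeUpTo g' n := by
  intro i k hk hik
  obtain ⟨j, hj, hne⟩ := h i k hk hik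
  exact ⟨j, hj, by rwa [← hg _ (by omega), ← hg _ (by omega)]⟩

/-- Thue's criterion: a uniform morphism is squarefree as soon as it preserves squarefreeness of
the words of length three. -/
theorem IsUniformOfRank.isSquarefreeMorphism_iff {α : Type*} [Nontrivial α] {L : ℕ}
    {φ : FreeMonoid α →* FreeMonoid α} (hφ : IsUniformOfRank L φ) :
    IsSquarefreeMorphism φ ↔ ∀ a b c, a ≠ b → b ≠ c →
      IsSquarefreeWord (φ (FreeMonoid.of a * FreeMonoid.of b * FreeMonoid.of c)) := by
  refine ⟨fun h a b c hab hbc => h _ (isSquarefreeWord_three hab hbc), fun h w hw => ?_⟩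
  obtain ⟨d⟩ : Nonempty α := inferInstance
  rcases Nat.eq_zero_or_pos L with rfl | hL
  · rw [isSquarefreeWord_iff_squarefreeUpTo _ d, hφ.length_apply]
    intro i k hk hik
    omega
  have H : SquarefreeOnTriples L fun a r => (φ (FreeMonoid.of a)).toList.getD r d := by
    intro a b c hab hbc
    have := h a b c hab hbc
    rw [isSquarefreeWord_iff_squarefreeUpTo _ d, hφ.length_apply] at this
    refine this.congr fun m hm => (hφ.getD_apply d _ hm).trans ?_
    have hm' : m / L < 3 := Nat.div_lt_of_lt_mul (by
      simp only [FreeMonoid.length_mul, FreeMonoid.length_of] at hm; omega)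
    unfold blockSeq
    generalize m / L = t at hm'
    interval_cases t <;> rfl
  rw [isSquarefreeWord_iff_squarefreeUpTo _ d] at hw ⊢
  rw [hφ.length_apply]
  exact (H.squarefreeUpTo_blockSeq hL hw).congr fun m hm => (hφ.getD_apply d _ hm).symm

/-! ### Ternary words as natural numbers -/

/-- A ternary word as a number in base `4`, first letter least significant, the letter `a` being
the digit `a + 1`. As no digit is `0`, the number determines the word. -/
def encode : List (Fin 3) → ℕ
  | [] => 0
  | a :: w => 4 * encode w + (a.val + 1)

theorem encode_append (u v : List (Fin 3)) :
    encode (u ++ v) = encode u + 4 ^ u.length * encode v := by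
  induction u with
  | nil => simp [encode]
  | cons a u ih => simp only [List.cons_append, encode, ih, List.length_cons]; ring

theorem encode_lt (w : List (Fin 3)) : encode w < 4 ^ w.length := by
  induction w with
  | nil => simp [encode]
  | cons a w ih => rw [encode, List.length_cons, pow_succ]; omega

theorem encode_mod (w : List (Fin 3)) (k : ℕ) : encode w % 4 ^ k = encode (w.take k) := by
  rcases le_total k w.length with h | h
  · conv_lhs => rw [← List.take_append_drop k w, encode_append, List.length_take, min_eq_left h]
    rw [Nat.add_mul_mod_self_left, Nat.mod_eq_of_lt]
    exact (encode_lt _).trans_eq (by rw [List.length_take, min_eq_left h])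
  · rw [List.take_of_length_le h, Nat.mod_eq_of_lt]
    exact (encode_lt w).trans_le (Nat.pow_le_pow_right (by omega) h)

theorem encode_div (w : List (Fin 3)) (k : ℕ) : encode w / 4 ^ k = encode (w.drop k) := by
  rcases le_total k w.length with h | h
  · conv_lhs => rw [← List.take_append_drop k w, encode_append, List.length_take, min_eq_left h]
    rw [Nat.add_mul_div_left _ _ (by positivity), Nat.div_eq_of_lt, zero_add]
    exact (encode_lt _).trans_eq (by rw [List.length_take, min_eq_left h])
  · rw [List.drop_eq_nil_of_le h, Nat.div_eq_of_lt, encode]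
    exact (encode_lt w).trans_le (Nat.pow_le_pow_right (by omega) h)

theorem encode_injective : Function.Injective encode := by
  intro u
  induction u with
  | nil =>
    intro v h
    cases v with
    | nil => rfl
    | cons b v => simp [encode] at h
  | cons a u ih =>
    intro v h
    cases v with
    | nil => simp [encode] at h
    | cons b v =>
      simp only [encode] at h
      rw [ih (a₂ := v) (by omega), Fin.ext (a := a) (b := b) (by omega)]

/-! ### Testing squarefreeness of encoded words

The functions below are evaluated by the kernel. They use `Bool.rec`, `List.rec` and the binary
operations on `ℕ` directly, for these are the forms that it evaluates fast. -/

/-- The powers `4 ^ 1, …, 4 ^ n`. -/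
def fourPowers (n : ℕ) : List ℕ := (List.range n).map fun k => Nat.pow 4 (k + 1)

/-- No prefix of the encoded word `W` is a square of period `k` with `4 ^ k ∈ ps`. -/
noncomputable def noPrefixSquare (ps : List ℕ) (W : ℕ) : Bool :=
  List.rec true
    (fun p _ ih => Bool.rec ih false (Nat.beq (Nat.mod W p) (Nat.mod (Nat.div W p) p))) ps

/-- The encoded word `W` of length `n` is squarefree. -/
noncomputable def squarefreeCode (n : ℕ) : ℕ → Bool :=
  Nat.rec (fun _ => true)
    (fun m ih W => Bool.rec false (ih (Nat.div W 4))
      (noPrefixSquare (fourPowers (Nat.div (m + 1) 2)) W)) n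

theorem noPrefixSquare_eq_true_iff (ps : List ℕ) (W : ℕ) :
    noPrefixSquare ps W = true ↔ ∀ p ∈ ps, W % p ≠ W / p % p := by
  induction ps with
  | nil => simp [noPrefixSquare]
  | cons p ps ih =>
    have : noPrefixSquare (p :: ps) W =
        bif Nat.beq (W % p) (W / p % p) then false else noPrefixSquare ps W := by
      change @Bool.rec (fun _ => Bool) _ _ (Nat.beq (W % p) (W / p % p)) = _
      cases Nat.beq (W % p) (W / p % p) <;> rfl
    rw [this, List.forall_mem_cons, ← ih]
    cases h : Nat.beq (W % p) (W / p % p)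
    · simp [Nat.ne_of_beq_eq_false h]
    · simp [Nat.eq_of_beq_eq_true h]

theorem noPrefixSquare_encode (w : List (Fin 3)) (K : ℕ) :
    noPrefixSquare (fourPowers K) (encode w) = true ↔
      ∀ k, 0 < k → k ≤ K → w.take k ≠ (w.drop k).take k := by
  rw [noPrefixSquare_eq_true_iff]
  have key : ∀ k, encode w % 4 ^ k ≠ encode w / 4 ^ k % 4 ^ k ↔ w.take k ≠ (w.drop k).take k :=
    fun k => by rw [encode_mod, encode_div, encode_mod, encode_injective.ne_iff]
  simp only [fourPowers, List.forall_mem_map, List.mem_range]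
  constructor
  · intro h k hk hkK
    have := h (k - 1) (by omega)
    rw [Nat.sub_add_cancel hk] at this
    exact (key k).1 this
  · exact fun h k hk => (key _).2 (h _ (by omega) hk)

theorem isSquarefreeWord_cons_iff {α : Type*} (a : α) (w : List α) :
    IsSquarefreeWord (FreeMonoid.ofList (a :: w)) ↔
      (∀ k, 0 < k → k ≤ (w.length + 1) / 2 → (a :: w).take k ≠ ((a :: w).drop k).take k) ∧
        IsSquarefreeWord (FreeMonoid.ofList w) := by
  rw [isSquarefreeWord_iff_take_ne, isSquarefreeWord_iff_take_ne]
  simp only [FreeMonoid.toList_ofList, List.length_cons]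
  constructor
  · refine fun h => ⟨fun k hk hkK => ?_, fun i k hk hik => ?_⟩
    · simpa using h 0 k hk (by omega)
    · have := h (i + 1) k hk (by omega)
      rwa [Nat.add_right_comm, List.drop_succ_cons, List.drop_succ_cons] at this
  · rintro ⟨h0, h1⟩ i k hk hik
    cases i with
    | zero => simpa using h0 k hk (by omega)
    | succ i =>
      rw [Nat.add_right_comm, List.drop_succ_cons, List.drop_succ_cons]
      exact h1 i k hk (by omega)

theorem squarefreeCode_encode (w : List (Fin 3)) :
    squarefreeCode w.length (encode w) = true ↔ IsSquarefreeWord (FreeMonoid.ofList w) := by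
  induction w with
  | nil =>
    refine iff_of_true rfl ?_
    rw [isSquarefreeWord_iff_take_ne]
    intro i k hk hik
    simp at hik
    omega
  | cons a w ih =>
    have hdiv : encode (a :: w) / 4 = encode w := by simpa using encode_div (a :: w) 1
    have : squarefreeCode (a :: w).length (encode (a :: w)) =
        (noPrefixSquare (fourPowers ((w.length + 1) / 2)) (encode (a :: w)) &&
          squarefreeCode w.length (encode w)) := by
      rw [← hdiv]
      change @Bool.rec (fun _ => Bool) _ _ (noPrefixSquare (fourPowers ((w.length + 1) / 2)) (encode (a :: w))) = _
      cases noPrefixSquare (fourPowers ((w.length + 1) / 2)) (encode (a :: w)) <;> rfl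
    rw [this, Bool.and_eq_true, ih, noPrefixSquare_encode, isSquarefreeWord_cons_iff]

/-! ### Enumerating the codes of squarefree uniform morphisms -/

/-- All encoded words obtained from those in `l` by prepending a letter, without those that have a
square prefix of a period recorded in `ps`. -/
noncomputable def extendLeft (ps l : List ℕ) : List ℕ :=
  l.flatMap fun W =>
    [Nat.add (Nat.mul 4 W) 1, Nat.add (Nat.mul 4 W) 2, Nat.add (Nat.mul 4 W) 3].filter
      (noPrefixSquare ps)

/-- All squarefree extensions by `m` letters to the left of the words encoded in `l`, which are
squarefree of length `n`. -/
noncomputable def extendLeftBy (n : ℕ) : ℕ → List ℕ → List ℕ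
  | 0, l => l
  | m + 1, l => extendLeft (fourPowers (Nat.div (n + m + 1) 2)) (extendLeftBy n m l)

/-- The code of the concatenation of three words of length `L`. -/
def concatCode (L X Y Z : ℕ) : ℕ :=
  Nat.add X (Nat.mul (Nat.pow 4 L) (Nat.add Y (Nat.mul (Nat.pow 4 L) Z)))

/-- The codes of the words `z` of length `L` for which `z x z` and `x z x` are squarefree, where `x`
is the word of length `L` with code `X`. -/
noncomputable def companions (L X : ℕ) : List ℕ :=
  ((extendLeftBy L L [X]).map fun W => Nat.mod W (Nat.pow 4 L)).filter fun Z =>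
    squarefreeCode (3 * L) (concatCode L Z X Z) && squarefreeCode (3 * L) (concatCode L X Z X)

/-- The ternary words `a b c` with `a ≠ b` and `b ≠ c`. They are ordered so that the likely
failures come first. -/
def squarefreeTriples : List (Fin 3 × Fin 3 × Fin 3) :=
  [(0, 1, 2), (2, 1, 0), (1, 0, 2), (2, 0, 1), (0, 2, 1), (1, 2, 0),
    (1, 2, 1), (2, 1, 2), (0, 1, 0), (1, 0, 1), (0, 2, 0), (2, 0, 2)]

theorem mem_squarefreeTriples (a b c : Fin 3) :
    (a, b, c) ∈ squarefreeTriples ↔ a ≠ b ∧ b ≠ c := by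
  revert a b c; decide

/-- The substitution of the encoded words `C 0`, `C 1`, `C 2` of length `L` for the letters keeps
squarefree words of length three squarefree. -/
noncomputable def squarefreeOnTriplesCode (L : ℕ) (C : Fin 3 → ℕ) : Bool :=
  squarefreeTriples.all fun t => squarefreeCode (3 * L) (concatCode L (C t.1) (C t.2.1) (C t.2.2))

/-- The codes of the images of the letters under the squarefree uniform morphisms of rank `L` for
which the image of `0` ends with the letters `0`, `1`; the number `9` is the code of `0 1`. -/
noncomputable def candidates (L : ℕ) : List (ℕ × ℕ × ℕ) :=
  (extendLeftBy 2 (L - 2) [9]).flatMap fun X =>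
    (fun N : List ℕ => N.flatMap fun Y =>
      (N.filter fun Z => squarefreeOnTriplesCode L ![X, Y, Z]).map fun Z => (X, Y, Z))
      (companions L X)

theorem mem_extendLeft {ps l : List ℕ} {c : ℕ} : c ∈ extendLeft ps l ↔
    ∃ W ∈ l, ∃ a : Fin 3, c = 4 * W + (a.val + 1) ∧ noPrefixSquare ps c = true := by
  simp only [extendLeft, List.mem_flatMap, List.mem_filter, List.mem_cons, List.not_mem_nil,
    or_false, Fin.exists_fin_succ, Nat.add_eq, Nat.mul_eq]
  refine exists_congr fun W => and_congr_right fun _ => ?_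
  simp
  tauto

theorem encode_mem_extendLeftBy {n m : ℕ} {l : List ℕ} {w : List (Fin 3)}
    (hw : IsSquarefreeWord (FreeMonoid.ofList w)) (hlen : w.length = n + m)
    (hl : encode (w.drop m) ∈ l) : encode w ∈ extendLeftBy n m l := by
  induction m generalizing w with
  | zero => exact hl
  | succ m ih =>
    cases w with
    | nil => simp at hlen
    | cons a w =>
      have hlen' : w.length = n + m := by simpa [← add_assoc] using hlen
      rw [isSquarefreeWord_cons_iff, hlen'] at hw
      exact mem_extendLeft.2 ⟨encode w, ih hw.2 hlen' hl, a, rfl,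
        (noPrefixSquare_encode _ _).2 hw.1⟩

theorem exists_of_mem_extendLeftBy {n m : ℕ} {l : List ℕ} {c : ℕ} (hc : c ∈ extendLeftBy n m l) :
    ∃ u : List (Fin 3), u.length = m ∧ ∃ W ∈ l, c = encode u + 4 ^ m * W := by
  induction m generalizing c with
  | zero => exact ⟨[], rfl, c, hc, by simp [encode]⟩
  | succ m ih =>
    obtain ⟨W, hW, a, rfl, -⟩ := mem_extendLeft.1 hc
    obtain ⟨u, hu, V, hV, rfl⟩ := ih hW
    exact ⟨a :: u, by simp [hu], V, hV, by rw [encode]; ring⟩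

theorem squarefreeCode_concatCode {L : ℕ} {x y z : List (Fin 3)} (hx : x.length = L)
    (hy : y.length = L) (hz : z.length = L) :
    squarefreeCode (3 * L) (concatCode L (encode x) (encode y) (encode z)) = true ↔
      IsSquarefreeWord (FreeMonoid.ofList (x ++ (y ++ z))) := by
  rw [← squarefreeCode_encode, encode_append, encode_append, hx, hy,
    show (x ++ (y ++ z)).length = 3 * L by simp only [List.length_append]; omega]
  rfl

/-! ### Normalized morphisms and their codes -/

/-- The codes of the images of the letters. -/
def morphismCode (φ : FreeMonoid (Fin 3) →* FreeMonoid (Fin 3)) (a : Fin 3) : ℕ :=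
  encode (φ (FreeMonoid.of a)).toList

theorem squarefreeCode_morphismCode {L : ℕ} {φ : FreeMonoid (Fin 3) →* FreeMonoid (Fin 3)}
    (hφ : IsUniformOfRank L φ) (a b c : Fin 3) :
    squarefreeCode (3 * L)
        (concatCode L (morphismCode φ a) (morphismCode φ b) (morphismCode φ c)) = true ↔
      IsSquarefreeWord (φ (FreeMonoid.of a * FreeMonoid.of b * FreeMonoid.of c)) := by
  refine (squarefreeCode_concatCode (hφ a) (hφ b) (hφ c)).trans ?_
  simp [mul_assoc]

theorem squarefreeOnTriplesCode_morphismCode {L : ℕ}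
    {φ : FreeMonoid (Fin 3) →* FreeMonoid (Fin 3)} (hφ : IsUniformOfRank L φ) :
    squarefreeOnTriplesCode L (morphismCode φ) = true ↔ IsSquarefreeMorphism φ := by
  rw [hφ.isSquarefreeMorphism_iff, squarefreeOnTriplesCode, List.all_eq_true]
  constructor
  · intro h a b c hab hbc
    exact (squarefreeCode_morphismCode hφ a b c).1 (h _ ((mem_squarefreeTriples a b c).2 ⟨hab, hbc⟩))
  · rintro h ⟨a, b, c⟩ ht
    obtain ⟨hab, hbc⟩ := (mem_squarefreeTriples a b c).1 ht
    exact (squarefreeCode_morphismCode hφ a b c).2 (h a b c hab hbc)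

/-- The squarefree uniform morphisms of rank `L` on the ternary alphabet. -/
def squarefreeMorphisms (L : ℕ) : Set (FreeMonoid (Fin 3) →* FreeMonoid (Fin 3)) :=
  {φ | IsUniformOfRank L φ ∧ IsSquarefreeMorphism φ}

/-- The morphisms in `squarefreeMorphisms L` that are normalized by a permutation of the letters of
the target: the image of the letter `0` ends with `0 1`. -/
def normalizedMorphisms (L : ℕ) : Set (FreeMonoid (Fin 3) →* FreeMonoid (Fin 3)) :=
  {φ | φ ∈ squarefreeMorphisms L ∧ ∃ r, (φ (FreeMonoid.of 0)).toList = r ++ [0, 1]}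

/-- The search for companions misses nothing: the image of any other letter is found. -/
theorem morphismCode_mem_companions {L : ℕ} {φ : FreeMonoid (Fin 3) →* FreeMonoid (Fin 3)}
    (hφ : φ ∈ squarefreeMorphisms L) {a b : Fin 3} (hab : a ≠ b) :
    morphismCode φ b ∈ companions L (morphismCode φ a) := by
  obtain ⟨hu, hs⟩ := hφ
  have h3 := hu.isSquarefreeMorphism_iff.1 hs
  have ha : (φ (FreeMonoid.of a)).toList.length = L := hu a
  have hb : (φ (FreeMonoid.of b)).toList.length = L := hu b
  refine List.mem_filter.2 ⟨List.mem_map.2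
    ⟨encode ((φ (FreeMonoid.of b)).toList ++ (φ (FreeMonoid.of a)).toList), ?_, ?_⟩, ?_⟩
  · refine encode_mem_extendLeftBy ?_ (by simp [ha, hb]) ?_
    · have := h3 b a b hab.symm hab
      rw [map_mul, map_mul] at this
      exact this.of_mul_left
    · rw [← hb, List.drop_left]
      exact List.mem_singleton_self _
  · change _ % 4 ^ L = _
    rw [encode_mod, ← hb, List.take_left]
    rfl
  · rw [Bool.and_eq_true, squarefreeCode_morphismCode hu, squarefreeCode_morphismCode hu]
    exact ⟨h3 b a b hab.symm hab, h3 a b a hab hab.symm⟩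

theorem exists_of_mem_companions {L X Z : ℕ} (h : Z ∈ companions L X) :
    ∃ z : List (Fin 3), z.length = L ∧ encode z = Z := by
  obtain ⟨W, hW, rfl⟩ := List.mem_map.1 (List.mem_filter.1 h).1
  obtain ⟨u, hu, V, -, rfl⟩ := exists_of_mem_extendLeftBy hW
  refine ⟨u, hu, ?_⟩
  change _ = _ % 4 ^ L
  rw [Nat.add_mul_mod_self_left, Nat.mod_eq_of_lt (hu ▸ encode_lt u)]

/-- The search finds exactly the normalized morphisms. -/
theorem mem_candidates_iff {L : ℕ} (hL : 2 ≤ L) (C : ℕ × ℕ × ℕ) :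
    C ∈ candidates L ↔ ∃ φ ∈ normalizedMorphisms L,
      (morphismCode φ 0, morphismCode φ 1, morphismCode φ 2) = C := by
  simp only [candidates, List.mem_flatMap, List.mem_map, List.mem_filter]
  constructor
  · rintro ⟨X, hX, Y, hY, Z, ⟨hZ, ht⟩, rfl⟩
    obtain ⟨u, hu, W, hW, rfl⟩ := exists_of_mem_extendLeftBy hX
    obtain rfl := List.mem_singleton.1 hW
    obtain ⟨y, hy, rfl⟩ := exists_of_mem_companions hY
    obtain ⟨z, hz, rfl⟩ := exists_of_mem_companions hZ
    have hx : encode u + 4 ^ (L - 2) * 9 = encode (u ++ [0, 1]) := by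
      rw [encode_append, hu]
      rfl
    rw [hx] at ht ⊢
    let φ : FreeMonoid (Fin 3) →* FreeMonoid (Fin 3) :=
      FreeMonoid.lift fun a => FreeMonoid.ofList (![u ++ [0, 1], y, z] a)
    have hφ : ∀ a, (φ (FreeMonoid.of a)).toList = ![u ++ [0, 1], y, z] a := fun a =>
      congrArg FreeMonoid.toList (FreeMonoid.lift_eval_of _ a)
    have hu' : IsUniformOfRank L φ := by
      intro a
      rw [FreeMonoid.length, hφ]
      fin_cases a
      · simp [hu]; omega
      · exact hy
      · exact hz
    have hcode : morphismCode φ = ![encode (u ++ [0, 1]), encode y, encode z] := by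
      funext a
      rw [morphismCode, hφ]
      fin_cases a <;> rfl
    refine ⟨φ, ⟨⟨hu', ?_⟩, u, hφ 0⟩, by rw [hcode]; rfl⟩
    rwa [← squarefreeOnTriplesCode_morphismCode hu', hcode]
  · rintro ⟨φ, ⟨hφ, r, hr⟩, rfl⟩
    have hlen : r.length = L - 2 := by
      have : (φ (FreeMonoid.of 0)).toList.length = L := hφ.1 0
      rw [hr, List.length_append] at this
      simp at this
      omega
    refine ⟨_, ?_, _, morphismCode_mem_companions hφ (b := 1) (by decide), _,
      ⟨morphismCode_mem_companions hφ (b := 2) (by decide), ?_⟩, rfl⟩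
    · rw [morphismCode, hr]
      refine encode_mem_extendLeftBy ?_ (by simp [hlen]; omega) ?_
      · rw [← hr, FreeMonoid.ofList_toList]
        exact hφ.2 _ (isSquarefreeWord_of 0)
      · rw [← hlen, List.drop_left]
        exact List.mem_singleton_self _
    · rw [← (squarefreeOnTriplesCode_morphismCode hφ.1).2 hφ.2]
      congr 1
      funext a
      fin_cases a <;> rfl

theorem morphismCode_injective : Function.Injective fun φ =>
    (morphismCode φ 0, morphismCode φ 1, morphismCode φ 2) := by
  intro φ ψ h
  simp only [Prod.mk.injEq] at h
  refine FreeMonoid.hom_eq fun a => FreeMonoid.toList.injective (encode_injective ?_)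
  fin_cases a
  · exact h.1
  · exact h.2.1
  · exact h.2.2

theorem candidates_eleven : (candidates 11).Nodup ∧ (candidates 11).length = 24 := by
  decide +kernel

theorem candidates_eq_nil : ∀ L < 11, 2 ≤ L → candidates L = [] := by
  decide +kernel

theorem ncard_normalizedMorphisms {L : ℕ} (hL : 2 ≤ L) (hnd : (candidates L).Nodup) :
    (normalizedMorphisms L).ncard = (candidates L).length := by
  rw [← Set.ncard_image_of_injective _ morphismCode_injective, ← List.toFinset_card_of_nodup hnd,
    ← Set.ncard_coe_finset]
  congr 1
  ext C
  rw [Finset.mem_coe, List.mem_toFinset, mem_candidates_iff hL]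
  rfl

/-! ### Permuting the letters of the target -/

theorem isSquarefreeWord_map {α β : Type*} {σ : α → β} (hσ : Function.Injective σ)
    {w : FreeMonoid α} (hw : IsSquarefreeWord w) : IsSquarefreeWord (FreeMonoid.map σ w) := by
  rw [isSquarefreeWord_iff_take_ne] at hw ⊢
  intro i k hk hik
  rw [FreeMonoid.toList_map, List.length_map] at hik
  rw [FreeMonoid.toList_map, ← List.map_drop, ← List.map_drop, ← List.map_take, ← List.map_take]
  exact hσ.list_map.ne (hw i k hk hik)

theorem map_comp_mem_squarefreeMorphisms {L : ℕ} {φ : FreeMonoid (Fin 3) →* FreeMonoid (Fin 3)}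
    (hφ : φ ∈ squarefreeMorphisms L) (σ : Equiv.Perm (Fin 3)) :
    (FreeMonoid.map σ).comp φ ∈ squarefreeMorphisms L := by
  refine ⟨fun a => ?_, fun w hw => isSquarefreeWord_map σ.injective (hφ.2 w hw)⟩
  rw [← hφ.1 a]
  exact List.length_map ..

theorem map_symm_comp_map_comp (σ : Equiv.Perm (Fin 3))
    (φ : FreeMonoid (Fin 3) →* FreeMonoid (Fin 3)) :
    (FreeMonoid.map σ.symm).comp ((FreeMonoid.map σ).comp φ) = φ := by
  rw [← MonoidHom.comp_assoc, ← FreeMonoid.map_comp]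
  simp

/-- The last two letters of the image of `0` are distinct, hence some permutation takes them to
`0 1`. -/
theorem exists_map_comp_mem_normalizedMorphisms {L : ℕ} (hL : 2 ≤ L)
    {φ : FreeMonoid (Fin 3) →* FreeMonoid (Fin 3)} (hφ : φ ∈ squarefreeMorphisms L) :
    ∃ σ : Equiv.Perm (Fin 3), (FreeMonoid.map σ).comp φ ∈ normalizedMorphisms L := by
  have hlen : (φ (FreeMonoid.of 0)).toList.length = L := hφ.1 0
  obtain ⟨r, a, b, hw⟩ : ∃ r a b, (φ (FreeMonoid.of 0)).toList = r ++ [a, b] := by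
    obtain ⟨a, b, hab⟩ := List.length_eq_two.1
      (show ((φ (FreeMonoid.of 0)).toList.drop (L - 2)).length = 2 by rw [List.length_drop]; omega)
    exact ⟨_, a, b, by rw [← hab, List.take_append_drop]⟩
  have hne : a ≠ b := by
    rintro rfl
    refine FreeMonoid.of_ne_one a (hφ.2 _ (isSquarefreeWord_of 0) (.ofList r) _ 1 ?_)
    apply FreeMonoid.toList.injective
    rw [hw]
    simp
  obtain ⟨σ, h0, h1⟩ : ∃ σ : Equiv.Perm (Fin 3), σ a = 0 ∧ σ b = 1 := by
    clear hw
    revert a b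
    decide
  refine ⟨σ, map_comp_mem_squarefreeMorphisms hφ σ, r.map σ, ?_⟩
  rw [MonoidHom.comp_apply, FreeMonoid.toList_map, hw, List.map_append]
  simp [h0, h1]

/-- The permutations of the letters act on the squarefree morphisms, and each orbit is regular and
has one normalized element. -/
theorem ncard_squarefreeMorphisms {L : ℕ} (hL : 2 ≤ L) :
    (squarefreeMorphisms L).ncard = 6 * (normalizedMorphisms L).ncard := by
  have hcard : Nat.card (Equiv.Perm (Fin 3)) = 6 := by
    rw [Nat.card_perm, Nat.card_fin]; rfl
  rw [← Nat.card_coe_set_eq, ← Nat.card_coe_set_eq, ← hcard, ← Nat.card_prod]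
  symm
  refine Nat.card_congr (Equiv.ofBijective
    (fun p => ⟨(FreeMonoid.map p.1).comp p.2.1, map_comp_mem_squarefreeMorphisms p.2.2.1 p.1⟩)
    ⟨?_, ?_⟩)
  · rintro ⟨σ, φ, hφ, r, hr⟩ ⟨τ, ψ, hψ, s, hs⟩ h
    have h : (FreeMonoid.map σ).comp φ = (FreeMonoid.map τ).comp ψ := congrArg Subtype.val h
    have hlast : r.map σ ++ [σ 0, σ 1] = s.map τ ++ [τ 0, τ 1] := by
      have := congrArg (fun χ => (χ (FreeMonoid.of 0)).toList) h
      simpa only [MonoidHom.comp_apply, FreeMonoid.toList_map, hr, hs, List.map_append,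
        List.map_cons, List.map_nil] using this
    have h01 := List.append_inj_right' hlast rfl
    simp only [List.cons.injEq, and_true] at h01
    have hperm : ∀ σ τ : Equiv.Perm (Fin 3), σ 0 = τ 0 ∧ σ 1 = τ 1 → σ = τ := by decide
    obtain rfl := hperm σ τ h01
    obtain rfl : φ = ψ := by
      rw [← map_symm_comp_map_comp σ φ, h, map_symm_comp_map_comp]
    rfl
  · rintro ⟨φ, hφ⟩
    obtain ⟨σ, hσ⟩ := exists_map_comp_mem_normalizedMorphisms hL hφ
    exact ⟨(σ.symm, ⟨_, hσ⟩), Subtype.ext (map_symm_comp_map_comp σ φ)⟩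

theorem theorem9 :
    {φ : FreeMonoid (Fin 3) →* FreeMonoid (Fin 3) |
        IsUniformOfRank 11 φ ∧ IsSquarefreeMorphism φ}.ncard = 144 ∧
      ∀ L : ℕ, 2 ≤ L → L < 11 →
        ¬ ∃ φ : FreeMonoid (Fin 3) →* FreeMonoid (Fin 3),
          IsUniformOfRank L φ ∧ IsSquarefreeMorphism φ := by
  constructor
  · refine (ncard_squarefreeMorphisms (L := 11) (by decide)).trans ?_
    rw [ncard_normalizedMorphisms (by decide) candidates_eleven.1, candidates_eleven.2]
  · rintro L hL hL11 ⟨φ, hφ⟩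
    obtain ⟨σ, hσ⟩ := exists_map_comp_mem_normalizedMorphisms hL (φ := φ) hφ
    have := (mem_candidates_iff hL _).2 ⟨_, hσ, rfl⟩
    rw [candidates_eq_nil L hL11 hL] at this
    exact List.not_mem_nil this
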